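/- Let $U,W,V$ be complex vector spaces of dimensions $3,3,4$, with orientations, i.e. isomorphisms $\Lambda^3U\cong\mathbb C$, $\Lambda^3W\cong\mathbb C$, $\Lambda^4(V^\vee)\cong\mathbb C$, and let $B\in U^\vee\otimes W\otimes V^\vee$. Contraction with $B$ is a linear map $$\neg B:\ \Lambda^2(W^\vee)\otimes V\longrightarrow U^\vee\otimes W^\vee ;$$ put $U':=\ker(\neg B)$. The orientation of $W$ gives an isomorphism $\Lambda^2(W^\vee)\cong W$, hence a map $U'\to W\otimes V$, and a corresponding tensor $B'\in U'^\vee\otimes W\otimes V$. We say that $(U,W,V^\vee,B)$ satisfies the main assumption if $\neg B$ is surjective. (1) If $(U,W,V^\vee,B)$ satisfies the main assumption, then $\dim U'=3$, the map $U'\to W\otimes V$ is injective, and the orientations of $U$, $W$, $V^\vee$ and the exact sequence $0\to U'\to \Lambda^2(W^\vee)\otimes V\to U^\vee\otimes W^\vee\to0$ induce a well-defined orientation of $U'$. (If $a_i$, $b_j$ are unimodular bases of $U$, $W$ and $c_l$ is a basis of $V$ whose dual basis is unimodular, and if $s_{ij}$ is any lift of $a_i^*\otimes b_j^*$, then this orientation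 sends $k_1\wedge k_2\wedge k_3$ to the determinant of the $12$ vectors $k_i$, $s_{ij}$, taken in $W\otimes V$, in the basis $b_j\otimes c_l$, double indices being ordered lexicographically. It does not depend on the choices.) So the cross-product construction $(U,W,V^\vee,B)\mapsto(U',W,V,B')$ is well defined, $V$ being given the orientation dual to that of $V^\vee$. (2) The construction is an involution wherever it can be applied twice: if both $(U,W,V^\vee,B)$ and $(U',W,V,B')$ satisfy the main assumption and $(U'',W,V^\vee,B'')$ is obtained by applying it twice, then there is a unique isomorphism $U\cong U''$ which, together with the identity of $W$ and the canonical isomorphism $V\cong V^{\vee\vee}$, carries $B$ to $B''$. The orientations of $W$ and $V^\vee$ also return to the original ones, and $(U'',W,V^\vee,B'')$ again satisfies the main assumption. (3) For fixed $U,W,V$, the set of tensors $B$ that satisfy the main assumption is Zariski open in $U^\vee\otimes W\otimes V^\vee$, and the set of those $B$ for which $B'$ satisfies it too is Zariski open and non-empty (hence dense). -/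

import Mathlib

open Module TensorProduct

universe u

noncomputable section

/-! ### Multilinear algebra -/

section Multilinear

variable {U W V : Type u} [AddCommGroup U] [Module ℂ U] [AddCommGroup W] [Module ℂ W]
  [AddCommGroup V] [Module ℂ V]

-- Shortcut for instance search on submodules of `⋀² W ⊗ V`.
instance wedgeTwoTensorAddCommGroup : AddCommGroup (⋀[ℂ]^2 W ⊗[ℂ] V) :=
  TensorProduct.addCommGroup

/-- An orientation of an `n`-dimensional space `M` is an isomorphism `⋀ⁿ M ≃ ℂ`. A family
`b` of `n` vectors is unimodular for it if `b₀ ∧ ⋯ ∧ bₙ₋₁` is sent to `1`. -/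
def IsUnimodular {n : ℕ} (o : ⋀[ℂ]^n V ≃ₗ[ℂ] ℂ) (b : Fin n → V) : Prop :=
  o (exteriorPower.ιMulti ℂ n b) = 1

/-- Evaluation of `n`-forms on the oriented generator `o⁻¹(1)` of `⋀ⁿ M`. -/
def dualOrientationHom {n : ℕ} (o : ⋀[ℂ]^n V ≃ₗ[ℂ] ℂ) : ⋀[ℂ]^n (Dual ℂ V) →ₗ[ℂ] ℂ :=
  (exteriorPower.pairingDual ℂ V n).flip (o.symm 1)

theorem finrank_exteriorPower_top {M : Type u} [AddCommGroup M] [Module ℂ M]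
    [Module.Finite ℂ M] {n : ℕ} (hn : finrank ℂ M = n) : finrank ℂ (⋀[ℂ]^n M) = 1 := by
  rw [exteriorPower.finrank_eq, hn, Nat.choose_self]

theorem dualOrientationHom_bijective [Module.Finite ℂ V] {n : ℕ} (hn : finrank ℂ V = n)
    (o : ⋀[ℂ]^n V ≃ₗ[ℂ] ℂ) : Function.Bijective (dualOrientationHom o) := by
  have hd : finrank ℂ (⋀[ℂ]^n (Dual ℂ V)) = 1 :=
    finrank_exteriorPower_top (by rw [Subspace.dual_finrank_eq, hn])
  have hne : dualOrientationHom o ≠ 0 := by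
    intro h0
    let b : Basis (Fin n) ℂ V := finBasisOfFinrankEq ℂ V hn
    have h1 : exteriorPower.ιMulti ℂ n b
        = o (exteriorPower.ιMulti ℂ n b) • o.symm 1 := by
      apply o.injective
      simp
    have h2 : exteriorPower.pairingDual ℂ V n (exteriorPower.ιMulti ℂ n b.coord)
        (exteriorPower.ιMulti ℂ n b) = 1 := by
      rw [exteriorPower.pairingDual_ιMulti_ιMulti]
      convert Matrix.det_one (n := Fin n) (R := ℂ)
      ext i j
      simp [Matrix.one_apply, Finsupp.single_apply]
    have h3 := LinearMap.congr_fun h0 (exteriorPower.ιMulti ℂ n b.coord)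
    rw [h1, map_smul] at h2
    simp only [dualOrientationHom, LinearMap.flip_apply, LinearMap.zero_apply] at h3
    rw [h3] at h2
    simp at h2
  have hs : Function.Surjective (dualOrientationHom o) := LinearMap.surjective hne
  exact ⟨(LinearMap.injective_iff_surjective_of_finrank_eq_finrank
    (by rw [hd, finrank_self])).2 hs, hs⟩

/-- The orientation of `M^∨` dual to an orientation of `M`: the dual basis of a unimodular
basis is unimodular. -/
def dualOrientation [Module.Finite ℂ V] {n : ℕ} (hn : finrank ℂ V = n)
    (o : ⋀[ℂ]^n V ≃ₗ[ℂ] ℂ) : ⋀[ℂ]^n (Dual ℂ V) ≃ₗ[ℂ] ℂ :=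
  LinearEquiv.ofBijective (dualOrientationHom o) (dualOrientationHom_bijective hn o)

/-- The canonical isomorphism `⋀²(W^∨) → W` of an oriented `3`-dimensional space `W`: the
image `w` of `η` is determined by `γ(w) = (γ ∧ η)(o⁻¹(1))` for all `γ ∈ W^∨`. -/
def wedgeTwoDualToSelf [Module.Finite ℂ W] (o : ⋀[ℂ]^3 W ≃ₗ[ℂ] ℂ) :
    ⋀[ℂ]^2 (Dual ℂ W) →ₗ[ℂ] W :=
  (evalEquiv ℂ W).symm.toLinearMap ∘ₗ
    ((exteriorPower.alternatingMapLinearEquiv (R := ℂ) (M := Dual ℂ W) (N := ℂ)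
        (n := 2)).toLinearMap ∘ₗ
      ((dualOrientationHom o).compAlternatingMap
        (exteriorPower.ιMulti ℂ 3)).curryLeft).flip

theorem apply_wedgeTwoDualToSelf [Module.Finite ℂ W] (o : ⋀[ℂ]^3 W ≃ₗ[ℂ] ℂ)
    (γ α β : Dual ℂ W) :
    γ (wedgeTwoDualToSelf o (exteriorPower.ιMulti ℂ 2 ![α, β]))
      = dualOrientationHom o (exteriorPower.ιMulti ℂ 3 ![γ, α, β]) := by
  rw [wedgeTwoDualToSelf, LinearMap.comp_apply, LinearEquiv.coe_coe,
    apply_evalEquiv_symm_apply, LinearMap.flip_apply, LinearMap.comp_apply, LinearEquiv.coe_coe,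
    exteriorPower.alternatingMapLinearEquiv_apply_ιMulti]
  rfl

theorem ιMulti_two_add (w x y : W) : exteriorPower.ιMulti ℂ 2 ![w, x + y]
    = exteriorPower.ιMulti ℂ 2 ![w, x] + exteriorPower.ιMulti ℂ 2 ![w, y] := by
  have e : ∀ z, Function.update ![w, 0] 1 z = ![w, z] := fun z => by
    ext i; fin_cases i <;> rfl
  simpa only [e] using (exteriorPower.ιMulti ℂ 2 (M := W)).map_update_add ![w, 0] 1 x y

theorem ιMulti_two_smul (c : ℂ) (w x : W) : exteriorPower.ιMulti ℂ 2 ![w, c • x]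
    = c • exteriorPower.ιMulti ℂ 2 ![w, x] := by
  have e : ∀ z, Function.update ![w, 0] 1 z = ![w, z] := fun z => by
    ext i; fin_cases i <;> rfl
  simpa only [e] using (exteriorPower.ιMulti ℂ 2 (M := W)).map_update_smul ![w, 0] 1 c x

/-- The bilinear map `(w, w₂) ↦ w ∧ w₂`. -/
def wedgeTwo : W →ₗ[ℂ] W →ₗ[ℂ] ⋀[ℂ]^2 W :=
  LinearMap.mk₂ ℂ (fun w w₂ => exteriorPower.ιMulti ℂ 2 ![w, w₂])
    (fun x y m => (exteriorPower.ιMulti ℂ 2 (M := W)).map_vecCons_add ![m] x y)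
    (fun c x m => (exteriorPower.ιMulti ℂ 2 (M := W)).map_vecCons_smul ![m] c x)
    ιMulti_two_add ιMulti_two_smul

/-- Interior product `W → Hom(⋀²(W^∨), W^∨)`, `w ↦ (α ∧ β ↦ α(w) β - β(w) α)`: the form `η`
is sent to `w₂ ↦ η(w ∧ w₂)`. -/
def interiorProduct : W →ₗ[ℂ] ⋀[ℂ]^2 (Dual ℂ W) →ₗ[ℂ] Dual ℂ W :=
  LinearMap.mk₂ ℂ (fun w η => exteriorPower.pairingDual ℂ W 2 η ∘ₗ wedgeTwo w)
    (fun _ _ _ => by ext; simp) (fun _ _ _ => by ext; simp)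
    (fun _ _ _ => by ext; simp) (fun _ _ _ => by ext; simp)

theorem interiorProduct_ιMulti (w : W) (α β : Dual ℂ W) :
    interiorProduct w (exteriorPower.ιMulti ℂ 2 ![α, β]) = α w • β - β w • α := by
  ext w₂
  simp [interiorProduct, wedgeTwo, exteriorPower.pairingDual_ιMulti_ιMulti, Matrix.det_fin_two]

/-- Contraction of `⋀²(W^∨) ⊗ V` with an element of `W ⊗ V^∨`. -/
def contractionWV :
    W ⊗[ℂ] Dual ℂ V →ₗ[ℂ] (⋀[ℂ]^2 (Dual ℂ W) ⊗[ℂ] V →ₗ[ℂ] Dual ℂ W) :=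
  TensorProduct.lift <| LinearMap.mk₂ ℂ
    (fun w φ => (TensorProduct.rid ℂ (Dual ℂ W)).toLinearMap ∘ₗ
      TensorProduct.map (interiorProduct w) φ)
    (fun _ _ _ => by ext; simp [TensorProduct.map_add_left])
    (fun _ _ _ => by ext; simp [TensorProduct.map_smul_left])
    (fun _ _ _ => by ext; simp [TensorProduct.map_add_right])
    (fun _ _ _ => by ext; simp [TensorProduct.map_smul_right])

/-- The contraction `¬B : ⋀²(W^∨) ⊗ V → U^∨ ⊗ W^∨` with a tensor `B ∈ U^∨ ⊗ W ⊗ V^∨`. -/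
def contraction :
    Dual ℂ U ⊗[ℂ] (W ⊗[ℂ] Dual ℂ V) →ₗ[ℂ]
      (⋀[ℂ]^2 (Dual ℂ W) ⊗[ℂ] V →ₗ[ℂ] Dual ℂ U ⊗[ℂ] Dual ℂ W) :=
  TensorProduct.lift <| LinearMap.mk₂ ℂ
    (fun μ t => TensorProduct.mk ℂ (Dual ℂ U) (Dual ℂ W) μ ∘ₗ contractionWV t)
    (fun _ _ _ => by ext; simp)
    (fun _ _ _ => by ext; simp [TensorProduct.smul_tmul'])
    (fun _ _ _ => by ext; simp [TensorProduct.tmul_add])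
    (fun _ _ _ => by ext; simp)

theorem contraction_tmul (μ : Dual ℂ U) (w : W) (φ : Dual ℂ V) (η : ⋀[ℂ]^2 (Dual ℂ W)) (v : V) :
    contraction (μ ⊗ₜ[ℂ] (w ⊗ₜ[ℂ] φ)) (η ⊗ₜ[ℂ] v)
      = μ ⊗ₜ[ℂ] (φ v • interiorProduct w η) := by
  simp [contraction, contractionWV]

end Multilinear

/-- Zariski open subsets of a complex vector space: unions of non-vanishing loci of polynomial
functions, a polynomial function being a polynomial in linear forms. -/
def IsZariskiOpen {E : Type u} [AddCommGroup E] [Module ℂ E] (S : Set E) : Prop :=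
  ∀ x ∈ S, ∃ p : MvPolynomial (Dual ℂ E) ℂ,
    MvPolynomial.eval (fun l : Dual ℂ E => l x) p ≠ 0 ∧
    ∀ y, MvPolynomial.eval (fun l : Dual ℂ E => l y) p ≠ 0 → y ∈ S

/-! ### The `4`-tuples `(U, W, V^∨, B)` and the cross-product construction -/

/-- A `4`-tuple `(U, W, V^∨, B)`: complex vector spaces `U, W, V` of dimensions `3, 3, 4`,
orientations of `U`, `W` and `V^∨`, and a tensor `B ∈ U^∨ ⊗ W ⊗ V^∨`. -/
structure OrientedTensor where
  U : Type u
  W : Type u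
  V : Type u
  [addCommGroupU : AddCommGroup U]
  [moduleU : Module ℂ U]
  [addCommGroupW : AddCommGroup W]
  [moduleW : Module ℂ W]
  [addCommGroupV : AddCommGroup V]
  [moduleV : Module ℂ V]
  finrank_U : finrank ℂ U = 3
  finrank_W : finrank ℂ W = 3
  finrank_V : finrank ℂ V = 4
  oU : ⋀[ℂ]^3 U ≃ₗ[ℂ] ℂ
  oW : ⋀[ℂ]^3 W ≃ₗ[ℂ] ℂ
  oV : ⋀[ℂ]^4 (Dual ℂ V) ≃ₗ[ℂ] ℂ
  B : Dual ℂ U ⊗[ℂ] (W ⊗[ℂ] Dual ℂ V)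

namespace OrientedTensor

attribute [instance] addCommGroupU moduleU addCommGroupW moduleW addCommGroupV moduleV

variable (T : OrientedTensor.{u})

instance finiteU : Module.Finite ℂ T.U :=
  Module.finite_of_finrank_pos (by rw [T.finrank_U]; norm_num)

instance finiteW : Module.Finite ℂ T.W :=
  Module.finite_of_finrank_pos (by rw [T.finrank_W]; norm_num)

instance finiteV : Module.Finite ℂ T.V :=
  Module.finite_of_finrank_pos (by rw [T.finrank_V]; norm_num)

/-- The main assumption: the contraction `¬B : ⋀²(W^∨) ⊗ V → U^∨ ⊗ W^∨` is surjective. -/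
def MainAssumption : Prop := Function.Surjective (contraction T.B)

/-- `U' = ker (¬B : ⋀²(W^∨) ⊗ V → U^∨ ⊗ W^∨)`. -/
def crossKernel : Submodule ℂ (⋀[ℂ]^2 (Dual ℂ T.W) ⊗[ℂ] T.V) :=
  LinearMap.ker (contraction T.B)

/-- The canonical isomorphism `⋀²(W^∨) ⊗ V → W ⊗ V` given by the orientation of `W`. -/
def toWV : ⋀[ℂ]^2 (Dual ℂ T.W) ⊗[ℂ] T.V →ₗ[ℂ] T.W ⊗[ℂ] T.V :=
  TensorProduct.map (wedgeTwoDualToSelf T.oW) LinearMap.id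

/-- The natural inclusion `U' → W ⊗ V`. -/
def crossInclusion : T.crossKernel →ₗ[ℂ] T.W ⊗[ℂ] T.V :=
  T.toWV ∘ₗ T.crossKernel.subtype

/-- The tensor `B' ∈ U'^∨ ⊗ W ⊗ V` corresponding to the inclusion `U' → W ⊗ V`; the space `V`
is written as `(V^∨)^∨`. -/
def crossTensor : Dual ℂ T.crossKernel ⊗[ℂ] (T.W ⊗[ℂ] Dual ℂ (Dual ℂ T.V)) :=
  (dualTensorHomEquiv ℂ T.crossKernel (T.W ⊗[ℂ] Dual ℂ (Dual ℂ T.V))).symm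
    (TensorProduct.map LinearMap.id (evalEquiv ℂ T.V).toLinearMap ∘ₗ T.crossInclusion)

/-- The orientation of `U'` induced by those of `U`, `W`, `V^∨` and the exact sequence
`0 → U' → ⋀²(W^∨) ⊗ V → U^∨ ⊗ W^∨ → 0`. For unimodular bases `a`, `b` of `U`, `W` and a basis
`c` of `V` with unimodular dual basis, and for lifts `s (i, j)` of `a_i^* ⊗ b_j^*`, the value on
`k₀ ∧ k₁ ∧ k₂` is the determinant of the twelve vectors `k_i`, `s (i, j)` in the basis
corresponding to `b_i ⊗ c_j`. All double indices are ordered lexicographically. -/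
def IsInducedOrientation (o : ⋀[ℂ]^3 T.crossKernel ≃ₗ[ℂ] ℂ) : Prop :=
  ∀ (a : Basis (Fin 3) ℂ T.U) (b : Basis (Fin 3) ℂ T.W) (c : Basis (Fin 4) ℂ T.V),
    IsUnimodular T.oU a → IsUnimodular T.oW b → IsUnimodular T.oV c.dualBasis →
    ∀ s : Fin 3 × Fin 3 → ⋀[ℂ]^2 (Dual ℂ T.W) ⊗[ℂ] T.V,
      (∀ i j, contraction T.B (s (i, j)) = a.dualBasis i ⊗ₜ[ℂ] b.dualBasis j) →
      ∀ k : Fin 3 → T.crossKernel,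
        o (exteriorPower.ιMulti ℂ 3 k) =
          ((b.tensorProduct c).reindex
              (finProdFinEquiv.trans (finCongr (by norm_num : 3 * 4 = 3 + 3 * 3)))).det
            (Fin.append (fun i => T.toWV (k i)) (fun i => T.toWV (s (finProdFinEquiv.symm i))))

variable {T} in
theorem MainAssumption.finrank_crossKernel (h : T.MainAssumption) :
    finrank ℂ T.crossKernel = 3 := by
  have h1 := LinearMap.finrank_range_add_finrank_ker (contraction T.B)
  rw [LinearMap.range_eq_top.2 h, finrank_top, finrank_tensorProduct, finrank_tensorProduct,
    exteriorPower.finrank_eq, Subspace.dual_finrank_eq, Subspace.dual_finrank_eq,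
    T.finrank_U, T.finrank_W, T.finrank_V] at h1
  have h2 : Nat.choose 3 2 = 3 := rfl
  rw [h2] at h1
  change 3 * 3 + finrank ℂ T.crossKernel = 3 * 4 at h1
  omega

variable {T} in
theorem MainAssumption.nonempty_orientation (h : T.MainAssumption) :
    Nonempty (⋀[ℂ]^3 T.crossKernel ≃ₗ[ℂ] ℂ) :=
  FiniteDimensional.nonempty_linearEquiv_of_finrank_eq
    (by rw [finrank_exteriorPower_top h.finrank_crossKernel, finrank_self])

/-- The cross-product construction `(U, W, V^∨, B) ↦ (U', W, V, B')`. The third entry `V` is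
`(V^∨)^∨`, so that the new `4`-tuple has `V^∨` in the place of `V`. The orientation of `U'` is
the induced one, that of `W` is unchanged and that of `V` is dual to that of `V^∨`. -/
@[reducible] def crossProduct (h : T.MainAssumption) : OrientedTensor.{u} where
  U := T.crossKernel
  W := T.W
  V := Dual ℂ T.V
  finrank_U := h.finrank_crossKernel
  finrank_W := T.finrank_W
  finrank_V := by rw [Subspace.dual_finrank_eq, T.finrank_V]
  oU :=
    haveI := h.nonempty_orientation
    Classical.epsilon T.IsInducedOrientation
  oW := T.oW
  oV := dualOrientation (by rw [Subspace.dual_finrank_eq, T.finrank_V]) T.oV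
  B := T.crossTensor

/-- The `4`-tuple with the same oriented spaces and another tensor. -/
@[reducible] def withTensor (B : Dual ℂ T.U ⊗[ℂ] (T.W ⊗[ℂ] Dual ℂ T.V)) : OrientedTensor.{u} :=
  { T with B := B }

/-- Isomorphisms `φ, ψ, χ` of the spaces `U, W, V` carry the tensor of `T` to that of `S`. -/
def CarriesTensor (S : OrientedTensor.{u}) (φ : T.U ≃ₗ[ℂ] S.U) (ψ : T.W ≃ₗ[ℂ] S.W)
    (χ : T.V ≃ₗ[ℂ] S.V) : Prop :=
  TensorProduct.map φ.symm.toLinearMap.dualMap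
    (TensorProduct.map ψ.toLinearMap χ.symm.toLinearMap.dualMap) T.B = S.B

end OrientedTensor

end

/-! ### Volume forms and unimodular bases -/

section Volume

variable {V : Type u} [AddCommGroup V] [Module ℂ V]

/-! Read `B` as a map `U → W ⊗ V^∨` (`slice`) and identify `⋀²(W^∨)` with `W`. Contraction becomes
the `W^∨`-valued pairing of `W ⊗ V^∨` with `W ⊗ V` that combines evaluation of `V^∨` on `V` with the
cross product of `W`. So `U'` is the annihilator of the image of `U`, of dimension `12 - 9 = 3` when
`¬B` is onto. The cross product is skew (`interiorProduct_wedgeTwoDualToSelf`), hence annihilation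
is a symmetric relation (`contractionWV_swap`): `U''` is the annihilator of `U'` and contains the
image of `U`. `U` embeds (`MainAssumption.slice_injective`) and both dimensions are `3`, so `U =
U''`; injectivity of the slices also makes the isomorphism unique.

The induced orientation is well defined because two choices of lifts differ by an endomorphism that
is the identity on `U'` and has determinant `1` on the quotient (`exists_det_eq_one_of_lifts`),
while unimodular bases `b ⊗ c` differ by determinant `1`.

Surjectivity is the non-vanishing of some maximal minor, a polynomial in `B`. For the condition on
`B'`, Cramer's rule (`kernelLift`) gives kernel vectors polynomial in `B`, and a minor of the
pairing with them is again polynomial. Non-emptiness comes from a sparse tensor whose `B'` has the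
same shape, so that one explicit right inverse serves twice. -/

theorem IsUnimodular.apply_ιMulti {n : ℕ} {o : ⋀[ℂ]^n V ≃ₗ[ℂ] ℂ} {b : Basis (Fin n) ℂ V}
    (h : IsUnimodular o b) (v : Fin n → V) : o (exteriorPower.ιMulti ℂ n v) = b.det v := by
  have h1 := (o.toLinearMap.compAlternatingMap (exteriorPower.ιMulti ℂ n)).eq_smul_basis_det b
  have h2 := congrArg (fun f => f v) h1
  simp only [LinearMap.compAlternatingMap_apply, LinearEquiv.coe_coe,
    AlternatingMap.smul_apply] at h2
  rw [h2, show o (exteriorPower.ιMulti ℂ n b) = 1 from h, one_smul]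

theorem IsUnimodular.det_eq_one {n : ℕ} {o : ⋀[ℂ]^n V ≃ₗ[ℂ] ℂ} {b b' : Basis (Fin n) ℂ V}
    (h : IsUnimodular o b) (h' : IsUnimodular o b') : b.det b' = 1 := by
  rw [← h.apply_ιMulti]; exact h'

theorem exists_isUnimodular [Module.Finite ℂ V] {n : ℕ} (hn : finrank ℂ V = n + 1)
    (o : ⋀[ℂ]^(n + 1) V ≃ₗ[ℂ] ℂ) : ∃ b : Basis (Fin (n + 1)) ℂ V, IsUnimodular o b := by
  let b := finBasisOfFinrankEq ℂ V hn
  let f := o.toLinearMap.compAlternatingMap (exteriorPower.ιMulti ℂ (n + 1))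
  have hb : f b ≠ 0 := by
    rw [AlternatingMap.map_basis_ne_zero_iff]
    intro h0
    have h1 : o.toLinearMap = 0 := exteriorPower.linearMap_ext h0
    have h2 := LinearMap.congr_fun h1 (o.symm 1)
    simp at h2
  -- Dividing the zeroth vector by the volume of `b` normalises it. This needs at least one vector,
  -- hence dimension `n + 1`.
  let w : Fin (n + 1) → ℂˣ := Function.update 1 0 (Units.mk0 _ hb)⁻¹
  refine ⟨b.unitsSMul w, ?_⟩
  change f (b.unitsSMul w) = 1
  rw [f.eq_smul_basis_det b, AlternatingMap.smul_apply, b.det_unitsSMul_self,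
    Fin.prod_univ_succ]
  simp [w, hb]

theorem dualOrientationHom_ιMulti {n : ℕ} {o : ⋀[ℂ]^n V ≃ₗ[ℂ] ℂ} {b : Basis (Fin n) ℂ V}
    (h : IsUnimodular o b) (f : Fin n → Dual ℂ V) :
    dualOrientationHom o (exteriorPower.ιMulti ℂ n f) =
      Matrix.det (Matrix.of fun i j => f j (b i)) := by
  have h1 : o.symm 1 = exteriorPower.ιMulti ℂ n b := by
    rw [LinearEquiv.symm_apply_eq]; exact h.symm
  rw [dualOrientationHom, LinearMap.flip_apply, h1, exteriorPower.pairingDual_ιMulti_ιMulti]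

theorem IsUnimodular.dualBasis [Module.Finite ℂ V] {n : ℕ} (hn : finrank ℂ V = n)
    {o : ⋀[ℂ]^n V ≃ₗ[ℂ] ℂ} {b : Basis (Fin n) ℂ V} (h : IsUnimodular o b) :
    IsUnimodular (dualOrientation hn o) b.dualBasis := by
  change dualOrientationHom o _ = 1
  rw [dualOrientationHom_ιMulti h]
  convert Matrix.det_one (n := Fin n) (R := ℂ)
  ext i j
  simp [Matrix.one_apply, Finsupp.single_apply]

/-- By reflexivity the dual basis of `d` comes from `V`. The orientation lives on `V^∨`, but
determinants are taken in bases of `V`. -/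
theorem exists_dualBasis_eq [Module.Finite ℂ V] {n : ℕ} (d : Basis (Fin n) ℂ (Dual ℂ V)) :
    ∃ c : Basis (Fin n) ℂ V, ∀ i, c.dualBasis i = d i := by
  refine ⟨d.dualBasis.map (evalEquiv ℂ V).symm, fun i => ?_⟩
  refine (d.dualBasis.map (evalEquiv ℂ V).symm).ext fun j => ?_
  rw [Basis.dualBasis_apply_self, Basis.map_apply, apply_evalEquiv_symm_apply,
    Basis.dualBasis_apply_self]
  simp [eq_comm]

theorem det_dualBasis {n : ℕ} (c c' : Basis (Fin n) ℂ V) :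
    c.dualBasis.det c'.dualBasis = c'.det c := by
  rw [Basis.det_apply, Basis.det_apply, ← Matrix.det_transpose]
  congr 1
  ext i j
  simp [Basis.toMatrix_apply]

end Volume

section Tensor

variable {U W : Type u} [AddCommGroup U] [Module ℂ U] [AddCommGroup W] [Module ℂ W]

theorem det_tensorProduct {ι κ : Type*} [Fintype ι] [DecidableEq ι] [Fintype κ] [DecidableEq κ]
    (a a' : Basis ι ℂ U) (b b' : Basis κ ℂ W) :
    (a.tensorProduct b).det (a'.tensorProduct b') =
      a.det a' ^ Fintype.card κ * b.det b' ^ Fintype.card ι := by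
  rw [Basis.det_apply, Basis.det_apply, Basis.det_apply, ← Matrix.det_kronecker]
  congr 1
  ext ⟨i, j⟩ ⟨k, l⟩
  simp [Basis.toMatrix_apply, Matrix.kroneckerMap_apply, mul_comm]

end Tensor

/-! ### The oriented three-dimensional space -/

section ThreeDimensional

variable {W : Type u} [AddCommGroup W] [Module ℂ W] [Module.Finite ℂ W]

theorem wedgeTwoDualToSelf_injective (hW : finrank ℂ W = 3) (o : ⋀[ℂ]^3 W ≃ₗ[ℂ] ℂ) :
    Function.Injective (wedgeTwoDualToSelf o) := by
  obtain ⟨b, hb⟩ : ∃ b : Basis (Fin 3) ℂ W, IsUnimodular o b := exists_isUnimodular hW o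
  have hr : Function.Surjective (wedgeTwoDualToSelf o) := by
    rw [← LinearMap.range_eq_top, eq_top_iff, ← b.span_eq, Submodule.span_le]
    rintro _ ⟨i, rfl⟩
    -- Indices in `Fin 3` are cyclic, so this bivector goes to `b i` with sign `+1`.
    refine ⟨exteriorPower.ιMulti ℂ 2 ![b.coord (i + 1), b.coord (i + 2)], ?_⟩
    refine b.ext_elem fun j => ?_
    rw [← Basis.coord_apply, apply_wedgeTwoDualToSelf, dualOrientationHom_ιMulti hb,
      Matrix.det_fin_three]
    fin_cases i <;> fin_cases j <;> simp
  refine (LinearMap.injective_iff_surjective_of_finrank_eq_finrank ?_).2 hr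
  rw [exteriorPower.finrank_eq, Subspace.dual_finrank_eq, hW]
  rfl

/-- If `η`, `ζ` correspond to the vectors `p`, `q`, the left side is the form `vol(q, p, ·)`; the
identity is skew-symmetry of the volume form. It is checked on decomposable bivectors in unimodular
coordinates. -/
theorem interiorProduct_wedgeTwoDualToSelf (hW : finrank ℂ W = 3) (o : ⋀[ℂ]^3 W ≃ₗ[ℂ] ℂ)
    (η ζ : ⋀[ℂ]^2 (Dual ℂ W)) :
    interiorProduct (wedgeTwoDualToSelf o η) ζ = -interiorProduct (wedgeTwoDualToSelf o ζ) η := by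
  obtain ⟨b, hb⟩ : ∃ b : Basis (Fin 3) ℂ W, IsUnimodular o b := exists_isUnimodular hW o
  have key : interiorProduct ∘ₗ wedgeTwoDualToSelf o =
      -(interiorProduct ∘ₗ wedgeTwoDualToSelf o).flip := by
    refine exteriorPower.linearMap_ext ?_
    ext1 f
    refine exteriorPower.linearMap_ext ?_
    ext1 g
    have hf : f = ![f 0, f 1] := by ext1 i; fin_cases i <;> rfl
    have hg : g = ![g 0, g 1] := by ext1 i; fin_cases i <;> rfl
    rw [hf, hg]
    generalize f 0 = α, f 1 = β, g 0 = γ, g 1 = δ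
    simp only [LinearMap.compAlternatingMap_apply, LinearMap.comp_apply, LinearMap.neg_apply,
      LinearMap.flip_apply, interiorProduct_ιMulti, apply_wedgeTwoDualToSelf,
      dualOrientationHom_ιMulti hb, Matrix.det_fin_three]
    refine b.ext fun j => ?_
    fin_cases j <;> simp <;> ring
  exact LinearMap.congr_fun₂ key η ζ

end ThreeDimensional

/-! ### Contraction as a pairing -/

section Pairing

variable {U W V : Type u} [AddCommGroup U] [Module ℂ U] [AddCommGroup W] [Module ℂ W]
  [AddCommGroup V] [Module ℂ V]

theorem contractionWV_tmul (w : W) (φ : Dual ℂ V) (η : ⋀[ℂ]^2 (Dual ℂ W)) (v : V) :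
    contractionWV (w ⊗ₜ[ℂ] φ) (η ⊗ₜ[ℂ] v) = φ v • interiorProduct w η := by
  simp [contractionWV]

theorem dualTensorHom_contraction (B : Dual ℂ U ⊗[ℂ] (W ⊗[ℂ] Dual ℂ V))
    (e : ⋀[ℂ]^2 (Dual ℂ W) ⊗[ℂ] V) (x : U) :
    dualTensorHom ℂ U (Dual ℂ W) (contraction B e) x =
      contractionWV (dualTensorHom ℂ U (W ⊗[ℂ] Dual ℂ V) B x) e := by
  induction B with
  | zero => simp
  | tmul μ t => simp [contraction]
  | add B C hB hC => simp only [map_add, LinearMap.add_apply, hB, hC]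

/-- Skewness of the cross product, tensored with the evaluation of `V^∨` on `V`, lets the two
arguments of the pairing trade places at the cost of a sign. -/
theorem contractionWV_swap [Module.Finite ℂ W] [Module.Finite ℂ V] (hW : finrank ℂ W = 3)
    (o : ⋀[ℂ]^3 W ≃ₗ[ℂ] ℂ) (e : ⋀[ℂ]^2 (Dual ℂ W) ⊗[ℂ] V)
    (e' : ⋀[ℂ]^2 (Dual ℂ W) ⊗[ℂ] Dual ℂ V) :
    contractionWV (TensorProduct.map LinearMap.id (evalEquiv ℂ V).toLinearMap
        (TensorProduct.map (wedgeTwoDualToSelf o) LinearMap.id e)) e' =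
      -contractionWV (TensorProduct.map (wedgeTwoDualToSelf o) LinearMap.id e') e := by
  induction e with
  | zero => simp
  | add x y hx hy => simp only [map_add, LinearMap.add_apply, hx, hy, neg_add]
  | tmul η v =>
    induction e' with
    | zero => simp
    | add x y hx hy => simp only [map_add, LinearMap.add_apply, hx, hy, neg_add]
    | tmul ζ φ =>
      simp only [TensorProduct.map_tmul, LinearMap.id_apply, LinearEquiv.coe_coe,
        contractionWV_tmul, evalEquiv_apply, Dual.eval_apply,
        interiorProduct_wedgeTwoDualToSelf hW o η ζ, smul_neg]

theorem contractionWV_map_evalEquiv [Module.Finite ℂ V] (t : W ⊗[ℂ] Dual ℂ V)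
    (e : ⋀[ℂ]^2 (Dual ℂ W) ⊗[ℂ] V) :
    contractionWV (TensorProduct.map LinearMap.id (evalEquiv ℂ (Dual ℂ V)).toLinearMap t)
        (TensorProduct.map LinearMap.id (evalEquiv ℂ V).toLinearMap e) = contractionWV t e := by
  induction t with
  | zero => simp
  | add x y hx hy => simp only [map_add, LinearMap.add_apply, hx, hy]
  | tmul w φ =>
    induction e with
    | zero => simp
    | add x y hx hy => simp only [map_add, hx, hy]
    | tmul η v => simp [contractionWV_tmul]

/-- The isomorphism `⋀²(W^∨) ⊗ V ≃ W ⊗ V` given by the orientation of `W`. -/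
noncomputable def wedgeTwoDualTensorEquiv [Module.Finite ℂ W] (hW : finrank ℂ W = 3)
    (o : ⋀[ℂ]^3 W ≃ₗ[ℂ] ℂ) (V : Type u) [AddCommGroup V] [Module ℂ V] :
    ⋀[ℂ]^2 (Dual ℂ W) ⊗[ℂ] V ≃ₗ[ℂ] W ⊗[ℂ] V :=
  TensorProduct.congr (LinearEquiv.ofBijective (wedgeTwoDualToSelf o)
    ⟨wedgeTwoDualToSelf_injective hW o,
      (LinearMap.injective_iff_surjective_of_finrank_eq_finrank (by
        rw [exteriorPower.finrank_eq, Subspace.dual_finrank_eq, hW]; rfl)).1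
        (wedgeTwoDualToSelf_injective hW o)⟩) (LinearEquiv.refl ℂ V)

end Pairing

/-! ### The tensor as a linear map `U → W ⊗ V^∨` -/

namespace OrientedTensor

variable (T : OrientedTensor.{u})

/-- The map `U → W ⊗ V^∨` corresponding to the tensor `B`. -/
noncomputable def slice : T.U →ₗ[ℂ] T.W ⊗[ℂ] Dual ℂ T.V :=
  dualTensorHom ℂ T.U (T.W ⊗[ℂ] Dual ℂ T.V) T.B

theorem contraction_eq_iff (e : ⋀[ℂ]^2 (Dual ℂ T.W) ⊗[ℂ] T.V) (y : Dual ℂ T.U ⊗[ℂ] Dual ℂ T.W) :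
    contraction T.B e = y ↔
      ∀ x, contractionWV (T.slice x) e = dualTensorHom ℂ T.U (Dual ℂ T.W) y x := by
  rw [← (dualTensorHomEquiv ℂ T.U (Dual ℂ T.W)).injective.eq_iff, LinearMap.ext_iff]
  simp only [slice, ← dualTensorHom_contraction]
  rfl

theorem mainAssumption_iff : T.MainAssumption ↔
    ∀ g : T.U →ₗ[ℂ] Dual ℂ T.W, ∃ e, ∀ x, contractionWV (T.slice x) e = g x := by
  refine ⟨fun h g => ?_, fun h y => ?_⟩
  · obtain ⟨e, he⟩ := h ((dualTensorHomEquiv ℂ T.U (Dual ℂ T.W)).symm g)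
    refine ⟨e, fun x => ?_⟩
    rw [(T.contraction_eq_iff e _).1 he x]
    exact LinearMap.congr_fun ((dualTensorHomEquiv ℂ T.U (Dual ℂ T.W)).apply_symm_apply g) x
  · obtain ⟨e, he⟩ := h (dualTensorHom ℂ T.U (Dual ℂ T.W) y)
    exact ⟨e, (T.contraction_eq_iff e y).2 he⟩

theorem mem_crossKernel_iff (e : ⋀[ℂ]^2 (Dual ℂ T.W) ⊗[ℂ] T.V) :
    e ∈ T.crossKernel ↔ ∀ x, contractionWV (T.slice x) e = 0 := by
  rw [crossKernel, LinearMap.mem_ker, contraction_eq_iff]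
  simp

variable {T} in
-- Every `g : U → W^∨` is realised by contracting slices, so it kills any `x` with zero slice.
-- Taking `g = f(·) β` with `β ≠ 0` gives `f x = 0` for every functional `f`.
theorem MainAssumption.slice_injective (h : T.MainAssumption) : Function.Injective T.slice := by
  rw [injective_iff_map_eq_zero]
  intro x hx
  have : Nontrivial (Dual ℂ T.W) := Module.nontrivial_of_finrank_pos (R := ℂ) (by
    rw [Subspace.dual_finrank_eq, T.finrank_W]; norm_num)
  obtain ⟨β, hβ⟩ := exists_ne (0 : Dual ℂ T.W)
  refine (forall_dual_apply_eq_zero_iff ℂ x).1 fun f => ?_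
  obtain ⟨e, he⟩ := T.mainAssumption_iff.1 h (f.smulRight β)
  have h1 := he x
  rw [hx, map_zero, LinearMap.zero_apply, LinearMap.smulRight_apply, eq_comm,
    smul_eq_zero] at h1
  exact h1.resolve_right hβ

/-- The isomorphism `⋀²(W^∨) ⊗ V ≃ W ⊗ V` given by the orientation of `W`. -/
noncomputable def toWVEquiv : ⋀[ℂ]^2 (Dual ℂ T.W) ⊗[ℂ] T.V ≃ₗ[ℂ] T.W ⊗[ℂ] T.V :=
  wedgeTwoDualTensorEquiv T.finrank_W T.oW T.V

theorem toWVEquiv_apply (e : ⋀[ℂ]^2 (Dual ℂ T.W) ⊗[ℂ] T.V) : T.toWVEquiv e = T.toWV e := rfl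

theorem crossInclusion_injective : Function.Injective T.crossInclusion :=
  T.toWVEquiv.injective.comp T.crossKernel.injective_subtype

theorem slice_crossProduct (h : T.MainAssumption) (k : T.crossKernel) :
    (T.crossProduct h).slice k =
      TensorProduct.map LinearMap.id (evalEquiv ℂ T.V).toLinearMap (T.toWV k) :=
  LinearMap.congr_fun ((dualTensorHomEquiv ℂ T.crossKernel
    (T.W ⊗[ℂ] Dual ℂ (Dual ℂ T.V))).apply_symm_apply _) k

theorem contractionWV_slice_crossProduct (h : T.MainAssumption) (k : T.crossKernel)
    (e : ⋀[ℂ]^2 (Dual ℂ T.W) ⊗[ℂ] Dual ℂ T.V) :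
    contractionWV ((T.crossProduct h).slice k) e =
      -contractionWV ((T.crossProduct h).toWV e) (k : ⋀[ℂ]^2 (Dual ℂ T.W) ⊗[ℂ] T.V) := by
  rw [slice_crossProduct]
  exact contractionWV_swap T.finrank_W T.oW _ _

end OrientedTensor

/-! ### The construction is an involution -/

namespace OrientedTensor

theorem dualTensorHom_map {U U₂ X X₂ : Type u} [AddCommGroup U] [Module ℂ U] [AddCommGroup U₂]
    [Module ℂ U₂] [AddCommGroup X] [Module ℂ X] [AddCommGroup X₂] [Module ℂ X₂]
    (f : U₂ →ₗ[ℂ] U) (g : X →ₗ[ℂ] X₂) (B : Dual ℂ U ⊗[ℂ] X) (x : U₂) :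
    dualTensorHom ℂ U₂ X₂ (TensorProduct.map f.dualMap g B) x =
      g (dualTensorHom ℂ U X B (f x)) := by
  induction B with
  | zero => simp
  | tmul μ t => simp
  | add B C hB hC => simp only [map_add, LinearMap.add_apply, hB, hC]

theorem carriesTensor_iff {T S : OrientedTensor.{u}} {φ : T.U ≃ₗ[ℂ] S.U} {ψ : T.W ≃ₗ[ℂ] S.W}
    {χ : T.V ≃ₗ[ℂ] S.V} : T.CarriesTensor S φ ψ χ ↔ ∀ x, S.slice x =
      TensorProduct.map ψ.toLinearMap χ.symm.toLinearMap.dualMap (T.slice (φ.symm x)) := by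
  rw [CarriesTensor, ← (dualTensorHomEquiv ℂ S.U (S.W ⊗[ℂ] Dual ℂ S.V)).injective.eq_iff,
    LinearMap.ext_iff]
  refine forall_congr' fun x => ?_
  rw [eq_comm]
  exact (congrArg (_ = ·) (dualTensorHom_map φ.symm.toLinearMap _ T.B x)).to_iff

theorem dualMap_evalEquiv_symm (V : Type u) [AddCommGroup V] [Module ℂ V] [Module.Finite ℂ V] :
    (evalEquiv ℂ V).symm.toLinearMap.dualMap = (evalEquiv ℂ (Dual ℂ V)).toLinearMap := by
  ext φ x
  obtain ⟨v, rfl⟩ := (evalEquiv ℂ V).surjective x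
  simp

variable (T : OrientedTensor.{u})

/-- The slices of `B'` are the elements of `U'`; swapping the arguments of the pairing exhibits
`U''` as the annihilator of `U'`. -/
theorem mem_crossKernel_crossProduct_iff (h : T.MainAssumption)
    (e : ⋀[ℂ]^2 (Dual ℂ T.W) ⊗[ℂ] Dual ℂ T.V) : e ∈ (T.crossProduct h).crossKernel ↔
      ∀ k ∈ T.crossKernel, contractionWV ((T.crossProduct h).toWV e) k = 0 := by
  rw [mem_crossKernel_iff]
  constructor
  · intro H k hk
    have h1 := H ⟨k, hk⟩
    rw [contractionWV_slice_crossProduct, neg_eq_zero] at h1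
    exact h1
  · intro H k
    rw [contractionWV_slice_crossProduct, H _ k.2, neg_zero]

/-- The map `U → U''` given by `B`. -/
noncomputable def toDoubleCross (h : T.MainAssumption) :
    T.U →ₗ[ℂ] (T.crossProduct h).crossKernel :=
  LinearMap.codRestrict _ ((T.crossProduct h).toWVEquiv.symm.toLinearMap ∘ₗ T.slice) fun x => by
    rw [mem_crossKernel_crossProduct_iff]
    intro k hk
    rw [← toWVEquiv_apply, LinearMap.comp_apply, LinearEquiv.coe_coe,
      LinearEquiv.apply_symm_apply]
    exact (T.mem_crossKernel_iff k).1 hk x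

theorem toWV_toDoubleCross (h : T.MainAssumption) (x : T.U) :
    (T.crossProduct h).toWV (T.toDoubleCross h x) = T.slice x :=
  (T.crossProduct h).toWVEquiv.apply_symm_apply (T.slice x)

theorem toDoubleCross_injective (h : T.MainAssumption) :
    Function.Injective (T.toDoubleCross h) := fun x y hxy => h.slice_injective <| by
  rw [← toWV_toDoubleCross T h, hxy, toWV_toDoubleCross]

/-- The isomorphism `U ≃ U''` given by `B`. -/
noncomputable def doubleCrossEquiv (h : T.MainAssumption)
    (h' : (T.crossProduct h).MainAssumption) :
    T.U ≃ₗ[ℂ] (T.crossProduct h).crossKernel :=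
  LinearEquiv.ofInjectiveOfFinrankEq (T.toDoubleCross h) (T.toDoubleCross_injective h)
    (T.finrank_U.trans h'.finrank_crossKernel.symm)

/-- The condition on `φ` is that the slice of `B''` at `φ x` is that of `B` at `x`, up to biduality.
`doubleCrossEquiv` has this property by construction, and injectivity of the slices excludes any
other `φ`. -/
theorem carriesTensor_doubleCross_iff (h : T.MainAssumption)
    (h' : (T.crossProduct h).MainAssumption)
    (φ : T.U ≃ₗ[ℂ] ((T.crossProduct h).crossProduct h').U) :
    T.CarriesTensor ((T.crossProduct h).crossProduct h') φ
      (LinearEquiv.refl ℂ T.W) (evalEquiv ℂ T.V) ↔ φ = T.doubleCrossEquiv h h' := by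
  rw [carriesTensor_iff, LinearEquiv.ext_iff]
  have hs : ∀ x, ((T.crossProduct h).crossProduct h').slice (T.doubleCrossEquiv h h' x) =
      TensorProduct.map LinearMap.id (evalEquiv ℂ (Dual ℂ T.V)).toLinearMap (T.slice x) :=
    fun x => by
      rw [slice_crossProduct]
      exact congrArg _ (T.toWV_toDoubleCross h x)
  have hinj : Function.Injective
      (TensorProduct.map (LinearMap.id : T.W →ₗ[ℂ] T.W)
        (evalEquiv ℂ (Dual ℂ T.V)).toLinearMap) :=
    (TensorProduct.congr (LinearEquiv.refl ℂ T.W) (evalEquiv ℂ (Dual ℂ T.V))).injective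
  rw [dualMap_evalEquiv_symm]
  constructor
  · intro H x
    obtain ⟨y, hy⟩ := (T.doubleCrossEquiv h h').surjective (φ x)
    have h1 := H (φ x)
    rw [LinearEquiv.symm_apply_apply, ← hy, hs] at h1
    rw [← hy, h.slice_injective (hinj h1)]
  · intro H x
    obtain ⟨y, rfl⟩ := φ.surjective x
    rw [LinearEquiv.symm_apply_apply, H y, hs]
    rfl

theorem mainAssumption_doubleCross (h : T.MainAssumption)
    (h' : (T.crossProduct h).MainAssumption) :
    ((T.crossProduct h).crossProduct h').MainAssumption := by
  rw [mainAssumption_iff]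
  intro g
  obtain ⟨e, he⟩ := T.mainAssumption_iff.1 h (g ∘ₗ (T.doubleCrossEquiv h h').toLinearMap)
  -- `B''` is `B` up to isomorphism, so a preimage for `B`, moved to the bidual of `V`, is a
  -- preimage for `B''`.
  refine ⟨TensorProduct.map LinearMap.id (evalEquiv ℂ T.V).toLinearMap e, fun x => ?_⟩
  obtain ⟨y, rfl⟩ := (T.doubleCrossEquiv h h').surjective x
  refine Eq.trans ?_ (he y)
  rw [carriesTensor_iff.1 ((T.carriesTensor_doubleCross_iff h h' _).2 rfl),
    dualMap_evalEquiv_symm, LinearEquiv.symm_apply_apply]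
  exact contractionWV_map_evalEquiv _ _

/-- Two top-degree forms agree once they agree on one basis. On the double dual of a unimodular
basis `d` both sides are `1`, as the transpose of evaluation sends it back to `d`. -/
theorem dualOrientation_dualOrientation (h : T.MainAssumption)
    (h' : (T.crossProduct h).MainAssumption) (ξ : ⋀[ℂ]^4 (Dual ℂ (Dual ℂ (Dual ℂ T.V)))) :
    ((T.crossProduct h).crossProduct h').oV ξ =
      T.oV (exteriorPower.map 4 (evalEquiv ℂ T.V).toLinearMap.dualMap ξ) := by
  have hd : finrank ℂ (Dual ℂ T.V) = 4 := by rw [Subspace.dual_finrank_eq, T.finrank_V]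
  have hd' : finrank ℂ (Dual ℂ (Dual ℂ T.V)) = 4 := by rw [Subspace.dual_finrank_eq, hd]
  obtain ⟨d, hu⟩ : ∃ d : Basis (Fin 4) ℂ (Dual ℂ T.V), IsUnimodular T.oV d :=
    exists_isUnimodular hd T.oV
  have hu' := (hu.dualBasis hd).dualBasis hd'
  have key : (dualOrientation hd' (dualOrientation hd T.oV)).toLinearMap =
      T.oV.toLinearMap ∘ₗ exteriorPower.map 4 (evalEquiv ℂ T.V).toLinearMap.dualMap := by
    refine exteriorPower.linearMap_ext ?_
    rw [AlternatingMap.eq_smul_basis_det d.dualBasis.dualBasis (LinearMap.compAlternatingMap _ _),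
      AlternatingMap.eq_smul_basis_det d.dualBasis.dualBasis
        (LinearMap.compAlternatingMap (T.oV.toLinearMap ∘ₗ _) _)]
    congr 1
    refine Eq.trans hu' ?_
    rw [LinearMap.compAlternatingMap_apply, LinearMap.comp_apply,
      exteriorPower.map_apply_ιMulti]
    refine (Eq.trans ?_ hu).symm
    refine congrArg (fun m => T.oV (exteriorPower.ιMulti ℂ 4 m))
      (funext fun i => LinearMap.ext fun v => ?_)
    simp
  exact LinearMap.congr_fun key ξ

end OrientedTensor

/-! ### The induced orientation -/

section ExactSequence

variable {E Y : Type u} [AddCommGroup E] [Module ℂ E] [AddCommGroup Y] [Module ℂ Y]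

/-- Take `f = id + g ∘ π`, where `g` sends `y i` to `s' i - s i`. It is the identity on `ker π` and
induces the base change from `y` to `y'` on the quotient; determinants multiply along the exact
sequence. -/
theorem exists_det_eq_one_of_lifts [Module.Finite ℂ E] {ι : Type*} [Fintype ι] [DecidableEq ι]
    (π : E →ₗ[ℂ] Y) (y y' : Basis ι ℂ Y) (hy : y.det y' = 1) (s s' : ι → E)
    (hs : ∀ i, π (s i) = y i) (hs' : ∀ i, π (s' i) = y' i) :
    ∃ f : E →ₗ[ℂ] E, LinearMap.det f = 1 ∧ (∀ k ∈ LinearMap.ker π, f k = k) ∧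
      ∀ i, f (s i) = s' i := by
  have hπ : Function.Surjective π := by
    rw [← LinearMap.range_eq_top, eq_top_iff, ← y.span_eq, Submodule.span_le]
    rintro _ ⟨i, rfl⟩
    exact ⟨s i, hs i⟩
  let f : E →ₗ[ℂ] E := LinearMap.id + y.constr ℂ (fun i => s' i - s i) ∘ₗ π
  have hk : ∀ k ∈ LinearMap.ker π, f k = k := fun k hk => by
    simp [f, LinearMap.mem_ker.1 hk]
  have hfs : ∀ i, f (s i) = s' i := fun i => by simp [f, hs]
  refine ⟨f, ?_, hk, hfs⟩
  have hle : LinearMap.ker π ≤ (LinearMap.ker π).comap f := fun k hk' => by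
    rw [Submodule.mem_comap, hk k hk']; exact hk'
  let τ : Y →ₗ[ℂ] Y := y.constr ℂ y'
  have hπf : π ∘ₗ f = τ ∘ₗ π := by
    have h1 : π ∘ₗ y.constr ℂ (fun i => s' i - s i) = τ - LinearMap.id :=
      y.ext fun i => by simp [τ, hs, hs']
    rw [LinearMap.comp_add, LinearMap.comp_id, ← LinearMap.comp_assoc, h1]
    ext x
    simp
  let q := π.quotKerEquivOfSurjective hπ
  have hq : (LinearMap.ker π).mapQ _ f hle = q.symm.toLinearMap ∘ₗ τ ∘ₗ q.toLinearMap := by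
    ext x
    rw [LinearMap.comp_apply, LinearMap.comp_apply, LinearMap.comp_apply, LinearMap.comp_apply,
      LinearEquiv.coe_coe, LinearEquiv.eq_symm_apply]
    exact LinearMap.congr_fun hπf x
  have hr : f.restrict hle = LinearMap.id := by
    ext x
    exact hk x x.2
  rw [LinearMap.det_eq_det_mul_det _ f hle, hr, LinearMap.det_id, one_mul, hq]
  have h2 := LinearMap.det_conj τ q.symm
  rw [LinearEquiv.symm_symm] at h2
  rw [h2, ← hy, ← mul_one (LinearMap.det τ), ← y.det_self, ← Basis.det_comp]
  congr 1
  ext i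
  simp [τ]

theorem det_eq_of_det_eq_one {ι : Type*} [Fintype ι] [DecidableEq ι] (b b' : Basis ι ℂ E)
    (h : b'.det b = 1) : b.det = b'.det := by
  rw [b'.det.eq_smul_basis_det b, h, one_smul]

theorem linearIndependent_append {m n : ℕ} (π : E →ₗ[ℂ] Y) (k : Fin m → LinearMap.ker π)
    (hk : LinearIndependent ℂ k) (s : Fin n → E) (hs : LinearIndependent ℂ (π ∘ s)) :
    LinearIndependent ℂ (Fin.append (fun i => (k i : E)) s) := by
  rw [Fintype.linearIndependent_iff] at hs ⊢
  intro g hg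
  simp only [Fin.sum_univ_add, Fin.append_left, Fin.append_right] at hg
  have h1 := congrArg π hg
  simp only [map_add, map_sum, map_smul, LinearMap.map_coe_ker, smul_zero,
    Finset.sum_const_zero, zero_add, map_zero] at h1
  have h2 := hs _ h1
  simp only [h2, zero_smul, Finset.sum_const_zero, add_zero] at hg
  have h3 := Fintype.linearIndependent_iff.1 hk (fun i => g (Fin.castAdd n i))
    (Subtype.ext (by simpa using hg))
  exact fun i => Fin.addCases h3 h2 i

theorem append_update {m n : ℕ} {α : Type*} [DecidableEq (Fin m)] (k : Fin m → α)
    (s : Fin n → α) (i : Fin m) (z : α) : Fin.append (Function.update k i z) s =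
      Function.update (Fin.append k s) (Fin.castAdd n i) z := by
  ext j
  refine Fin.addCases (fun j => ?_) (fun j => ?_) j
  · rcases eq_or_ne j i with rfl | hj
    · simp
    · simp [Function.update_of_ne hj, Function.update_of_ne
        (fun h => hj (Fin.castAdd_injective m n h) : Fin.castAdd n j ≠ Fin.castAdd n i)]
  · rw [Fin.append_right, Function.update_of_ne, Fin.append_right]
    intro h
    have h1 := congrArg Fin.val h
    have h2 := i.2
    simp only [Fin.val_natAdd, Fin.val_castAdd] at h1
    omega

/-- The alternating form obtained from an alternating form on `E` by fixing its last arguments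
and restricting the first ones to a submodule. -/
noncomputable def appendForm {m n : ℕ} (ω : E [⋀^Fin (m + n)]→ₗ[ℂ] ℂ) (s : Fin n → E)
    (K : Submodule ℂ E) : K [⋀^Fin m]→ₗ[ℂ] ℂ where
  toFun k := ω (Fin.append (fun i => (k i : E)) s)
  map_update_add' k i x y := by
    have h : ∀ z : K, (fun j => (Function.update k i z j : E)) =
        Function.update (fun j => (k j : E)) i z := fun z => by
      ext1 j
      exact Function.apply_update (fun _ (x : K) => (x : E)) k i z j
    simp only [h, append_update, Submodule.coe_add, AlternatingMap.map_update_add]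
  map_update_smul' k i c x := by
    have h : ∀ z : K, (fun j => (Function.update k i z j : E)) =
        Function.update (fun j => (k j : E)) i z := fun z => by
      ext1 j
      exact Function.apply_update (fun _ (x : K) => (x : E)) k i z j
    simp only [h, append_update, Submodule.coe_smul, AlternatingMap.map_update_smul]
  map_eq_zero_of_eq' k i j hij hne :=
    ω.map_eq_zero_of_eq (Fin.append (fun i => (k i : E)) s) (i := Fin.castAdd n i)
      (j := Fin.castAdd n j) (by simpa using hij) (by simpa using hne)

theorem appendForm_apply {m n : ℕ} (ω : E [⋀^Fin (m + n)]→ₗ[ℂ] ℂ) (s : Fin n → E)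
    (K : Submodule ℂ E) (k : Fin m → K) :
    appendForm ω s K k = ω (Fin.append (fun i => (k i : E)) s) := rfl

/-- Only non-vanishing of the form needs proof. A basis of the kernel together with the `s i` is
independent, hence by counting a basis of `E`, so its determinant is a unit. -/
theorem exists_orientation_of_lifts {m n : ℕ} [Module.Finite ℂ E] (π : E →ₗ[ℂ] Y)
    (hm : finrank ℂ (LinearMap.ker π) = m) (D : Basis (Fin (m + n)) ℂ E) (s : Fin n → E)
    (hs : LinearIndependent ℂ (π ∘ s)) :
    ∃ o : ⋀[ℂ]^m (LinearMap.ker π) ≃ₗ[ℂ] ℂ, ∀ k : Fin m → LinearMap.ker π,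
      o (exteriorPower.ιMulti ℂ m k) = D.det (Fin.append (fun i => (k i : E)) s) := by
  let ω := appendForm D.det s (LinearMap.ker π)
  let F := exteriorPower.alternatingMapLinearEquiv ω
  have hFω : ∀ k, F (exteriorPower.ιMulti ℂ m k) = ω k :=
    exteriorPower.alternatingMapLinearEquiv_apply_ιMulti ω
  have hF : F ≠ 0 := by
    intro h0
    let k := finBasisOfFinrankEq ℂ _ hm
    have hli := linearIndependent_append π k k.linearIndependent s hs
    have h2 := (Basis.is_basis_iff_det D).1 ⟨hli,
      hli.span_eq_top_of_card_eq_finrank' (finrank_eq_card_basis D).symm⟩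
    rw [← appendForm_apply] at h2
    change IsUnit (ω k) at h2
    rw [← hFω, h0] at h2
    exact not_isUnit_zero h2
  have hFs : Function.Surjective F := LinearMap.surjective hF
  exact ⟨LinearEquiv.ofBijective F ⟨(LinearMap.injective_iff_surjective_of_finrank_eq_finrank
    (by rw [finrank_exteriorPower_top hm, finrank_self])).2 hFs, hFs⟩, hFω⟩

end ExactSequence

namespace OrientedTensor

variable (T : OrientedTensor.{u})

theorem exists_isUnimodular_U : ∃ a : Basis (Fin 3) ℂ T.U, IsUnimodular T.oU a :=
  exists_isUnimodular T.finrank_U T.oU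

theorem exists_isUnimodular_W : ∃ b : Basis (Fin 3) ℂ T.W, IsUnimodular T.oW b :=
  exists_isUnimodular T.finrank_W T.oW

theorem exists_isUnimodular_dualBasis :
    ∃ c : Basis (Fin 4) ℂ T.V, IsUnimodular T.oV c.dualBasis := by
  obtain ⟨d, hd⟩ : ∃ d : Basis (Fin 4) ℂ (Dual ℂ T.V), IsUnimodular T.oV d :=
    exists_isUnimodular (by rw [Subspace.dual_finrank_eq, T.finrank_V]) T.oV
  obtain ⟨c, hc⟩ := exists_dualBasis_eq d
  exact ⟨c, by rwa [show ⇑c.dualBasis = d from funext hc]⟩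

/-- The basis `b_i ⊗ c_j` of `W ⊗ V`, ordered lexicographically. -/
noncomputable abbrev lexBasis (b : Basis (Fin 3) ℂ T.W) (c : Basis (Fin 4) ℂ T.V) :
    Basis (Fin (3 + 3 * 3)) ℂ (T.W ⊗[ℂ] T.V) :=
  (b.tensorProduct c).reindex (finProdFinEquiv.trans (finCongr (by norm_num : 3 * 4 = 3 + 3 * 3)))

/-- The transition determinant is a product of powers of those on `W` and `V`, each equal to `1`. -/
theorem det_lexBasis {b b' : Basis (Fin 3) ℂ T.W} {c c' : Basis (Fin 4) ℂ T.V}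
    (hb : IsUnimodular T.oW b) (hb' : IsUnimodular T.oW b')
    (hc : IsUnimodular T.oV c.dualBasis) (hc' : IsUnimodular T.oV c'.dualBasis) :
    (T.lexBasis b c).det = (T.lexBasis b' c').det := by
  refine det_eq_of_det_eq_one _ _ ?_
  have h1 : T.lexBasis b c ∘ finProdFinEquiv.trans
      (finCongr (by norm_num : 3 * 4 = 3 + 3 * 3)) = b.tensorProduct c := by
    ext i
    simp [lexBasis]
  rw [Basis.det_reindex, h1, det_tensorProduct, hb'.det_eq_one hb, ← det_dualBasis,
    hc.det_eq_one hc', one_pow, one_pow, one_mul]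

/-- The family `k_i`, `s (i, j)` of twelve vectors of `⋀²(W^∨) ⊗ V`. -/
def liftFamily (k : Fin 3 → T.crossKernel)
    (s : Fin 3 × Fin 3 → ⋀[ℂ]^2 (Dual ℂ T.W) ⊗[ℂ] T.V) :
    Fin (3 + 3 * 3) → ⋀[ℂ]^2 (Dual ℂ T.W) ⊗[ℂ] T.V :=
  Fin.append (fun i => (k i : ⋀[ℂ]^2 (Dual ℂ T.W) ⊗[ℂ] T.V))
    (fun i => s (finProdFinEquiv.symm i))

theorem toWV_liftFamily (k : Fin 3 → T.crossKernel)
    (s : Fin 3 × Fin 3 → ⋀[ℂ]^2 (Dual ℂ T.W) ⊗[ℂ] T.V) :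
    Fin.append (fun i => T.toWV (k i)) (fun i => T.toWV (s (finProdFinEquiv.symm i))) =
      T.toWVEquiv ∘ T.liftFamily k s := by
  ext1 i
  refine Fin.addCases (fun i => ?_) (fun i => ?_) i <;>
    simp only [liftFamily, Function.comp_apply, Fin.append_left, Fin.append_right] <;> rfl

theorem lexBasis_det_toWV (b : Basis (Fin 3) ℂ T.W) (c : Basis (Fin 4) ℂ T.V)
    (k : Fin 3 → T.crossKernel) (s : Fin 3 × Fin 3 → ⋀[ℂ]^2 (Dual ℂ T.W) ⊗[ℂ] T.V) :
    (T.lexBasis b c).det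
        (Fin.append (fun i => T.toWV (k i)) (fun i => T.toWV (s (finProdFinEquiv.symm i)))) =
      ((T.lexBasis b c).map T.toWVEquiv.symm).det (T.liftFamily k s) := by
  rw [toWV_liftFamily, Basis.det_map]
  rfl

theorem det_lifts_eq {a a' : Basis (Fin 3) ℂ T.U} {b b' : Basis (Fin 3) ℂ T.W}
    {c c' : Basis (Fin 4) ℂ T.V} (ha : IsUnimodular T.oU a) (ha' : IsUnimodular T.oU a')
    (hb : IsUnimodular T.oW b) (hb' : IsUnimodular T.oW b')
    (hc : IsUnimodular T.oV c.dualBasis) (hc' : IsUnimodular T.oV c'.dualBasis)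
    (s s' : Fin 3 × Fin 3 → ⋀[ℂ]^2 (Dual ℂ T.W) ⊗[ℂ] T.V)
    (hs : ∀ i j, contraction T.B (s (i, j)) = a.dualBasis i ⊗ₜ[ℂ] b.dualBasis j)
    (hs' : ∀ i j, contraction T.B (s' (i, j)) = a'.dualBasis i ⊗ₜ[ℂ] b'.dualBasis j)
    (k : Fin 3 → T.crossKernel) :
    (T.lexBasis b' c').det
        (Fin.append (fun i => T.toWV (k i)) (fun i => T.toWV (s' (finProdFinEquiv.symm i)))) =
      (T.lexBasis b c).det
        (Fin.append (fun i => T.toWV (k i)) (fun i => T.toWV (s (finProdFinEquiv.symm i)))) := by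
  obtain ⟨f, hf, hfk, hfs⟩ := exists_det_eq_one_of_lifts (contraction T.B)
    (a.dualBasis.tensorProduct b.dualBasis) (a'.dualBasis.tensorProduct b'.dualBasis)
    (by rw [det_tensorProduct, det_dualBasis, det_dualBasis, ha'.det_eq_one ha,
      hb'.det_eq_one hb, one_pow, one_mul]) s s'
    (fun ⟨i, j⟩ => by rw [hs, Basis.tensorProduct_apply])
    (fun ⟨i, j⟩ => by rw [hs', Basis.tensorProduct_apply])
  have h1 : T.liftFamily k s' = f ∘ T.liftFamily k s := by
    ext1 i
    refine Fin.addCases (fun i => ?_) (fun i => ?_) i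
    · simp only [liftFamily, Function.comp_apply, Fin.append_left]
      exact (hfk _ (k i).2).symm
    · simp only [liftFamily, Function.comp_apply, Fin.append_right, hfs]
  rw [T.det_lexBasis hb' hb hc' hc, lexBasis_det_toWV, lexBasis_det_toWV, h1, Basis.det_comp,
    hf, one_mul]

variable {T} in
theorem MainAssumption.exists_lifts (h : T.MainAssumption) (a : Basis (Fin 3) ℂ T.U)
    (b : Basis (Fin 3) ℂ T.W) : ∃ s : Fin 3 × Fin 3 → ⋀[ℂ]^2 (Dual ℂ T.W) ⊗[ℂ] T.V,
      ∀ i j, contraction T.B (s (i, j)) = a.dualBasis i ⊗ₜ[ℂ] b.dualBasis j :=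
  ⟨fun p => (h (a.dualBasis p.1 ⊗ₜ[ℂ] b.dualBasis p.2)).choose,
    fun i j => (h (a.dualBasis i ⊗ₜ[ℂ] b.dualBasis j)).choose_spec⟩

theorem exists_isInducedOrientation (h : T.MainAssumption) :
    ∃ o : ⋀[ℂ]^3 T.crossKernel ≃ₗ[ℂ] ℂ, T.IsInducedOrientation o := by
  refine T.exists_isUnimodular_U.elim fun a ha => T.exists_isUnimodular_W.elim fun b hb =>
    T.exists_isUnimodular_dualBasis.elim fun c hc => (h.exists_lifts a b).elim fun s hs => ?_
  have hs' : contraction T.B ∘ (fun i => s (finProdFinEquiv.symm i)) =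
      (a.dualBasis.tensorProduct b.dualBasis).reindex finProdFinEquiv := by
    ext1 i
    simp [hs, Basis.tensorProduct_apply']
  refine (exists_orientation_of_lifts (contraction T.B) h.finrank_crossKernel
    ((T.lexBasis b c).map T.toWVEquiv.symm) (fun i => s (finProdFinEquiv.symm i))
    (by rw [hs']; exact Basis.linearIndependent _)).imp fun o ho => ?_
  intro a' b' c' ha' hb' hc' s' hs' k
  exact (ho k).trans ((T.lexBasis_det_toWV b c k s).symm.trans
    (T.det_lifts_eq ha ha' hb hb' hc hc' s s' hs hs' k).symm)

theorem IsInducedOrientation.unique (h : T.MainAssumption)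
    {o o' : ⋀[ℂ]^3 T.crossKernel ≃ₗ[ℂ] ℂ} (ho : T.IsInducedOrientation o)
    (ho' : T.IsInducedOrientation o') : o = o' := by
  refine T.exists_isUnimodular_U.elim fun a ha => T.exists_isUnimodular_W.elim fun b hb =>
    T.exists_isUnimodular_dualBasis.elim fun c hc => (h.exists_lifts a b).elim fun s hs => ?_
  refine LinearEquiv.toLinearMap_injective (exteriorPower.linearMap_ext ?_)
  ext1 k
  exact (ho a b c ha hb hc s hs k).trans
    (ho' a b c ha hb hc s hs k).symm

/-- `crossProduct` picks its orientation by `Classical.epsilon`, which has the required property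
only because an induced orientation exists. -/
theorem isInducedOrientation_crossProduct (h : T.MainAssumption) :
    T.IsInducedOrientation (T.crossProduct h).oU :=
  haveI := h.nonempty_orientation
  Classical.epsilon_spec (T.exists_isInducedOrientation h)

end OrientedTensor

/-! ### Polynomial functions -/

section Polynomial

/-- The algebra of polynomial functions on a complex vector space. -/
noncomputable def polyFunctions (X : Type u) [AddCommGroup X] [Module ℂ X] :
    Subalgebra ℂ (X → ℂ) :=
  (MvPolynomial.aeval (R := ℂ) (fun (l : Dual ℂ X) (x : X) => l x)).range

variable {X : Type u} [AddCommGroup X] [Module ℂ X]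

theorem dual_mem_polyFunctions (l : Dual ℂ X) :
    (fun x => l x) ∈ polyFunctions X :=
  ⟨MvPolynomial.X l, MvPolynomial.aeval_X _ l⟩

theorem exists_eval_of_mem_polyFunctions {f : X → ℂ} (hf : f ∈ polyFunctions X) :
    ∃ p : MvPolynomial (Dual ℂ X) ℂ, ∀ x, MvPolynomial.eval (fun l : Dual ℂ X => l x) p = f x := by
  obtain ⟨p, rfl⟩ := hf
  refine ⟨p, fun x => ?_⟩
  induction p using MvPolynomial.induction_on with
  | C c => simp
  | add p q hp hq => simp_all
  | mul_X p l hp => simp_all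

theorem isZariskiOpen_of_polyFunctions {S : Set X}
    (h : ∀ x ∈ S, ∃ f ∈ polyFunctions X, f x ≠ 0 ∧ ∀ y, f y ≠ 0 → y ∈ S) :
    IsZariskiOpen S := by
  intro x hx
  obtain ⟨f, hf, hfx, hfS⟩ := h x hx
  obtain ⟨p, hp⟩ := exists_eval_of_mem_polyFunctions hf
  exact ⟨p, by rwa [hp], fun y hy => hfS y (by rwa [hp] at hy)⟩

theorem sum_mem_polyFunctions {ι : Type*} [Fintype ι] {F : X → ι → ℂ}
    (h : ∀ i, (fun x => F x i) ∈ polyFunctions X) :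
    (fun x => ∑ i, F x i) ∈ polyFunctions X := by
  have := Subalgebra.sum_mem _ fun i (_ : i ∈ Finset.univ) => h i
  convert this using 1
  ext x
  simp

variable {ι : Type*} [Fintype ι] [DecidableEq ι]

theorem det_mem_polyFunctions {M : X → Matrix ι ι ℂ}
    (h : ∀ i j, (fun x => M x i j) ∈ polyFunctions X) :
    (fun x => (M x).det) ∈ polyFunctions X := by
  have := Subalgebra.sum_mem _ fun σ (_ : σ ∈ (Finset.univ : Finset (Equiv.Perm ι))) =>
    Subalgebra.zsmul_mem _
      (Subalgebra.prod_mem _ fun i (_ : i ∈ Finset.univ) => h (σ i) i) (Equiv.Perm.sign σ : ℤ)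
  convert this using 1
  ext x
  simp [Matrix.det_apply, Units.smul_def]

variable {E Y : Type u} [AddCommGroup E] [Module ℂ E] [AddCommGroup Y] [Module ℂ Y]

theorem basis_det_mem_polyFunctions (y : Basis ι ℂ Y) {F : X → ι → Y}
    (h : ∀ i (l : Dual ℂ Y), (fun x => l (F x i)) ∈ polyFunctions X) :
    (fun x => y.det (F x)) ∈ polyFunctions X := by
  simp only [Basis.det_apply]
  exact det_mem_polyFunctions fun i j => h j (y.coord i)

theorem surjective_of_basis_det_ne_zero (L : E →ₗ[ℂ] Y) (y : Basis ι ℂ Y) (s : ι → E)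
    (h : y.det (fun i => L (s i)) ≠ 0) : Function.Surjective L := by
  have h1 := ((Basis.is_basis_iff_det y).2 (isUnit_iff_ne_zero.2 h)).2
  rw [← LinearMap.range_eq_top, eq_top_iff, ← h1, Submodule.span_le]
  rintro _ ⟨i, rfl⟩
  exact ⟨s i, rfl⟩

/-- A polynomial family of kernel vectors of a linear family `C` of linear maps, given by
Cramer's rule. -/
noncomputable def kernelLift (C : X →ₗ[ℂ] E →ₗ[ℂ] Y) (y : Basis ι ℂ Y) (s : ι → E) (k : E)
    (x : X) : E :=
  y.det (fun i => C x (s i)) • k -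
    ∑ i, (y.toMatrix fun i => C x (s i)).cramer (y.repr (C x k)) i • s i

/-- With `M` the matrix of the vectors `C x (s i)`, Cramer's rule `M (cramer M v) = det M • v` makes
the two terms cancel. Clearing the denominator `det M` keeps this valid for every `x`. -/
theorem apply_kernelLift (C : X →ₗ[ℂ] E →ₗ[ℂ] Y) (y : Basis ι ℂ Y) (s : ι → E) (k : E)
    (x : X) : C x (kernelLift C y s k x) = 0 := by
  refine y.ext_elem fun r => ?_
  have h := congrFun (Matrix.mulVec_cramer (y.toMatrix fun i => C x (s i)) (y.repr (C x k))) r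
  simp only [Matrix.mulVec, dotProduct, Pi.smul_apply, smul_eq_mul, Basis.toMatrix_apply] at h
  simp only [kernelLift, map_sub, map_smul, map_sum, Finsupp.coe_sub, Pi.sub_apply,
    Finsupp.coe_smul, Pi.smul_apply, smul_eq_mul, Finsupp.coe_finsetSum, Finset.sum_apply,
    map_zero, Finsupp.coe_zero, Pi.zero_apply, Basis.det_apply, ← h, sub_eq_zero]
  exact Finset.sum_congr rfl fun i _ => mul_comm _ _

theorem kernelLift_eq_self (C : X →ₗ[ℂ] E →ₗ[ℂ] Y) (y : Basis ι ℂ Y) (s : ι → E) (k : E)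
    (x : X) (hs : ∀ i, C x (s i) = y i) (hk : C x k = 0) : kernelLift C y s k x = k := by
  simp [kernelLift, hs, hk, y.det_self]

theorem kernelLift_mem_polyFunctions (C : X →ₗ[ℂ] E →ₗ[ℂ] Y) (y : Basis ι ℂ Y)
    (s : ι → E) (k : E) (l : Dual ℂ E) :
    (fun x => l (kernelLift C y s k x)) ∈ polyFunctions X := by
  have hC : ∀ (e : E) (m : Dual ℂ Y), (fun x => m (C x e)) ∈ polyFunctions X :=
    fun e m => dual_mem_polyFunctions (m ∘ₗ C.flip e)
  have hconst : ∀ c : ℂ, (fun _ : X => c) ∈ polyFunctions X :=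
    fun c => Subalgebra.algebraMap_mem _ c
  simp only [kernelLift, map_sub, map_smul, map_sum, smul_eq_mul]
  refine Subalgebra.sub_mem _ (Subalgebra.mul_mem _
    (basis_det_mem_polyFunctions y fun i m => hC (s i) m) (hconst _))
    (sum_mem_polyFunctions fun i => Subalgebra.mul_mem _ ?_ (hconst _))
  simp only [Matrix.cramer_apply]
  refine det_mem_polyFunctions fun p q => ?_
  rcases eq_or_ne q i with rfl | hq
  · simp only [Matrix.updateCol_self]
    exact hC k (y.coord p)
  · simp only [Matrix.updateCol_ne hq]
    exact hC (s q) (y.coord p)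

end Polynomial

/-! ### Openness -/

namespace OrientedTensor

variable (T : OrientedTensor.{u})

/-- Preimages of a basis under `¬B` are kept fixed while the tensor varies. The determinant of their
images is polynomial in the tensor, equals `1` at `B`, and forces surjectivity where it is non-zero.
-/
theorem isZariskiOpen_mainAssumption : IsZariskiOpen {B | (T.withTensor B).MainAssumption} := by
  refine isZariskiOpen_of_polyFunctions fun B hB => ?_
  let y := finBasis ℂ (Dual ℂ T.U ⊗[ℂ] Dual ℂ T.W)
  choose s hs using fun i => (show Function.Surjective (contraction B) from hB) (y i)
  refine ⟨fun B => y.det fun i => contraction B (s i),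
    basis_det_mem_polyFunctions y fun i l =>
      dual_mem_polyFunctions (l ∘ₗ contraction.flip (s i)), ?_,
    fun B' h' => surjective_of_basis_det_ne_zero (contraction B') y s h'⟩
  simp [hs, y.det_self]

/-- The pairing of `⋀²(W^∨) ⊗ V` and `⋀²(W^∨) ⊗ V^∨` with values in `W^∨` through which `¬B'` is
computed. -/
noncomputable def crossPairing : ⋀[ℂ]^2 (Dual ℂ T.W) ⊗[ℂ] T.V →ₗ[ℂ]
    ⋀[ℂ]^2 (Dual ℂ T.W) ⊗[ℂ] Dual ℂ T.V →ₗ[ℂ] Dual ℂ T.W :=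
  contractionWV ∘ₗ TensorProduct.map LinearMap.id (evalEquiv ℂ T.V).toLinearMap ∘ₗ T.toWV

/-- The pairings with the members of a family. -/
noncomputable def crossPairingFamily (k : Fin 3 → ⋀[ℂ]^2 (Dual ℂ T.W) ⊗[ℂ] T.V) :
    ⋀[ℂ]^2 (Dual ℂ T.W) ⊗[ℂ] Dual ℂ T.V →ₗ[ℂ] (Fin 3 → Dual ℂ T.W) :=
  LinearMap.pi fun i => T.crossPairing (k i)

theorem crossPairing_eq (h : T.MainAssumption) (k : T.crossKernel)
    (e : ⋀[ℂ]^2 (Dual ℂ T.W) ⊗[ℂ] Dual ℂ T.V) :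
    contractionWV ((T.crossProduct h).slice k) e = T.crossPairing k e := by
  rw [slice_crossProduct]
  rfl

/-- Three kernel vectors whose joint pairing is onto are automatically independent, hence a basis of
the three-dimensional `U'`. Thus no separate independence condition is needed. -/
theorem mainAssumption_crossProduct_of_surjective (h : T.MainAssumption)
    (k : Fin 3 → ⋀[ℂ]^2 (Dual ℂ T.W) ⊗[ℂ] T.V) (hk : ∀ i, k i ∈ T.crossKernel)
    (hs : Function.Surjective (T.crossPairingFamily k)) : (T.crossProduct h).MainAssumption := by
  let k' : Fin 3 → T.crossKernel := fun i => ⟨k i, hk i⟩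
  have : Nontrivial (Dual ℂ T.W) := Module.nontrivial_of_finrank_pos (R := ℂ) (by
    rw [Subspace.dual_finrank_eq, T.finrank_W]; norm_num)
  obtain ⟨β, hβ⟩ := exists_ne (0 : Dual ℂ T.W)
  have hli : LinearIndependent ℂ k' := by
    rw [Fintype.linearIndependent_iff]
    intro g hg i
    -- This `e` pairs to `β` with `k i` and to `0` with the others, which isolates the coefficient
    -- `g i`.
    obtain ⟨e, he⟩ := hs (Pi.single i β)
    have h1 := congrArg (fun z : T.crossKernel => T.crossPairing z e) hg
    have h2 : ∀ j, T.crossPairing (k j) e = (Pi.single i β : Fin 3 → Dual ℂ T.W) j :=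
      fun j => congrFun he j
    simp [k', h2, Pi.single_apply, hβ] at h1
    exact h1
  let K := basisOfLinearIndependentOfCardEqFinrank hli
    (by rw [h.finrank_crossKernel, Fintype.card_fin])
  have hK : ∀ i, K i = k' i := fun i => by simp [K]
  rw [mainAssumption_iff]
  intro g
  obtain ⟨e, he⟩ := hs fun i => g (k' i)
  refine ⟨e, fun x => ?_⟩
  rw [crossPairing_eq]
  have h3 : T.crossPairing.flip e ∘ₗ T.crossKernel.subtype = g :=
    K.ext fun i => by rw [hK]; exact congrFun he i
  exact LinearMap.congr_fun h3 x

/-- `U'` moves with the tensor, so a basis of it at `B` is extended to a family of kernel vectors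
`κ`, polynomial in the tensor. The polynomial used is a product: one determinant controls `¬B`, the
other the pairing with `κ`. -/
theorem isZariskiOpen_mainAssumption_crossProduct :
    IsZariskiOpen {B | ∃ h : (T.withTensor B).MainAssumption,
      ((T.withTensor B).crossProduct h).MainAssumption} := by
  refine isZariskiOpen_of_polyFunctions ?_
  rintro B ⟨hB, hB'⟩
  let y := finBasis ℂ (Dual ℂ T.U ⊗[ℂ] Dual ℂ T.W)
  let z := finBasis ℂ (Fin 3 → Dual ℂ T.W)
  choose s hs using fun i => (show Function.Surjective (contraction B) from hB) (y i)
  let K : Basis (Fin 3) ℂ (T.withTensor B).crossKernel :=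
    finBasisOfFinrankEq ℂ _ hB.finrank_crossKernel
  have hsurj : Function.Surjective (T.crossPairingFamily fun i => (K i).1) := fun x => by
    obtain ⟨e, he⟩ := (mainAssumption_iff _).1 hB' (K.constr ℂ x)
    refine ⟨e, funext fun i => ?_⟩
    refine (crossPairing_eq (T.withTensor B) hB (K i) e).symm.trans ((he (K i)).trans ?_)
    exact K.constr_basis ℂ x i
  choose t ht using fun i => hsurj (z i)
  let κ := fun B i => kernelLift contraction y s (K i).1 B
  have hκ : (κ B) = fun i => (K i).1 := funext fun i =>
    kernelLift_eq_self _ _ _ _ _ hs (K i).2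
  refine ⟨_, Subalgebra.mul_mem _
    (basis_det_mem_polyFunctions y (F := fun B i => contraction B (s i)) fun i l =>
      dual_mem_polyFunctions (l ∘ₗ contraction.flip (s i)))
    (basis_det_mem_polyFunctions z (F := fun B i => T.crossPairingFamily (κ B) (t i))
      fun i l => ?_), ?_, fun B₁ h₁ => ?_⟩
  -- Splitting `l` into its three components writes the entry as a sum of fixed functionals of the
  -- vectors `κ B j`.
  · have h1 : ∀ B, l (T.crossPairingFamily (κ B) (t i)) =
        ∑ j, (l ∘ₗ LinearMap.single ℂ _ j ∘ₗ T.crossPairing.flip (t i)) (κ B j) := fun B => by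
      conv_lhs => rw [← Finset.univ_sum_single (T.crossPairingFamily (κ B) (t i)), map_sum]
      rfl
    simp only [h1]
    exact sum_mem_polyFunctions fun j =>
      kernelLift_mem_polyFunctions contraction y s (K j).1 _
  · simp [hκ, hs, ht, Basis.det_self]
  · have h2 := mul_ne_zero_iff.1 h₁
    have hB₁ : (T.withTensor B₁).MainAssumption :=
      surjective_of_basis_det_ne_zero (contraction B₁) y s h2.1
    exact ⟨hB₁, mainAssumption_crossProduct_of_surjective (T.withTensor B₁) hB₁ (κ B₁)
      (fun i => apply_kernelLift contraction y s (K i).1 B₁)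
      (surjective_of_basis_det_ne_zero _ z t h2.2)⟩

end OrientedTensor

/-! ### A tensor to which the construction applies twice -/

section Example

variable {W V : Type u} [AddCommGroup W] [Module ℂ W] [AddCommGroup V] [Module ℂ V]

/-- Three sparse vectors of `X ⊗ Y`, built from `8` of the vectors `x_i ⊗ y_j`. -/
def sparseNet {X Y : Type u} [AddCommGroup X] [Module ℂ X] [AddCommGroup Y] [Module ℂ Y]
    (x : Fin 3 → X) (y : Fin 4 → Y) : Fin 3 → X ⊗[ℂ] Y :=
  ![x 0 ⊗ₜ y 3 + x 1 ⊗ₜ y 2 + x 2 ⊗ₜ y 0, x 0 ⊗ₜ y 1 + x 1 ⊗ₜ y 3 + x 2 ⊗ₜ y 2,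
    x 1 ⊗ₜ y 0 + x 2 ⊗ₜ y 1]

/-- The bivectors `b₁^* ∧ b₂^*`, `b₂^* ∧ b₀^*`, `b₀^* ∧ b₁^*`. -/
noncomputable def coordBivector (b : Basis (Fin 3) ℂ W) (i : Fin 3) : ⋀[ℂ]^2 (Dual ℂ W) :=
  exteriorPower.ιMulti ℂ 2 ![b.coord (i + 1), b.coord (i + 2)]

theorem interiorProduct_coordBivector (b : Basis (Fin 3) ℂ W) (i j : Fin 3) :
    interiorProduct (b j) (coordBivector b i) =
      (if i + 1 = j then b.coord (i + 2) else 0) - if i + 2 = j then b.coord (i + 1) else 0 := by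
  rw [coordBivector, interiorProduct_ιMulti]
  simp [Finsupp.single_apply, eq_comm]

theorem wedgeTwoDualToSelf_coordBivector [Module.Finite ℂ W] {o : ⋀[ℂ]^3 W ≃ₗ[ℂ] ℂ}
    {b : Basis (Fin 3) ℂ W} (hb : IsUnimodular o b) (i : Fin 3) :
    wedgeTwoDualToSelf o (coordBivector b i) = b i := by
  refine b.ext_elem fun j => ?_
  rw [coordBivector, ← Basis.coord_apply, apply_wedgeTwoDualToSelf, dualOrientationHom_ιMulti hb,
    Matrix.det_fin_three]
  fin_cases i <;> fin_cases j <;> simp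

/-- An explicit right inverse. About `φ` and `c` it uses only their duality, so it applies to the
example tensor and to its cross product alike. -/
theorem exists_contractionWV_sparseNet (b : Basis (Fin 3) ℂ W) (φ : Fin 4 → Dual ℂ V)
    (c : Fin 4 → V) (hφ : ∀ l m, φ l (c m) = if l = m then 1 else 0) (x : Fin 3 → Dual ℂ W) :
    ∃ e, ∀ i, contractionWV (sparseNet b φ i) e = x i := by
  have hx : ∀ i, x i = x i (b 0) • b.coord 0 + x i (b 1) • b.coord 1 + x i (b 2) • b.coord 2 :=
    fun i => b.ext fun m => by fin_cases m <;> simp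
  -- Each coefficient `x i (b m)` multiplies, up to the sign shown, an element whose contraction is
  -- `b.coord m` in slot `i` and zero in the other two.
  refine ⟨x 0 (b 0) • coordBivector b 1 ⊗ₜ c 0 +
    x 0 (b 1) • (coordBivector b 1 ⊗ₜ c 2 + coordBivector b 2 ⊗ₜ c 3) -
    x 0 (b 2) • coordBivector b 1 ⊗ₜ c 3 + x 1 (b 0) • coordBivector b 1 ⊗ₜ c 2 +
    x 1 (b 1) • coordBivector b 2 ⊗ₜ c 1 + x 1 (b 2) • coordBivector b 0 ⊗ₜ c 3 -
    x 2 (b 0) • coordBivector b 2 ⊗ₜ c 0 - x 2 (b 1) • coordBivector b 0 ⊗ₜ c 1 +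
    x 2 (b 2) • (coordBivector b 0 ⊗ₜ c 0 + coordBivector b 1 ⊗ₜ c 2 +
      coordBivector b 2 ⊗ₜ c 3), fun i => ?_⟩
  rw [hx i]
  fin_cases i <;>
    simp [sparseNet, contractionWV_tmul, interiorProduct_coordBivector, hφ] <;> module

end Example

namespace OrientedTensor

variable (T : OrientedTensor.{u})

theorem nonempty_mainAssumption_crossProduct :
    {B | ∃ h : (T.withTensor B).MainAssumption,
      ((T.withTensor B).crossProduct h).MainAssumption}.Nonempty := by
  obtain ⟨b, hb⟩ := T.exists_isUnimodular_W
  let a : Basis (Fin 3) ℂ T.U := finBasisOfFinrankEq ℂ _ T.finrank_U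
  let c : Basis (Fin 4) ℂ T.V := finBasisOfFinrankEq ℂ _ T.finrank_V
  let B : Dual ℂ T.U ⊗[ℂ] (T.W ⊗[ℂ] Dual ℂ T.V) :=
    ∑ i, a.dualBasis i ⊗ₜ sparseNet b c.dualBasis i
  have hB : ∀ i, (T.withTensor B).slice (a i) = sparseNet b c.dualBasis i := fun i => by
    simp [slice, B, Finsupp.single_apply]
  have h : (T.withTensor B).MainAssumption := by
    rw [mainAssumption_iff]
    intro g
    obtain ⟨e, he⟩ := exists_contractionWV_sparseNet b c.dualBasis c
      (fun l m => by simp [Finsupp.single_apply, eq_comm]) fun i => g (a i)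
    refine ⟨e, fun x => ?_⟩
    have h1 : contractionWV.flip e ∘ₗ (T.withTensor B).slice = g :=
      a.ext fun i => by
        rw [LinearMap.comp_apply, LinearMap.flip_apply]
        exact (congrArg (fun t => contractionWV t e) (hB i)).trans (he i)
    exact LinearMap.congr_fun h1 x
  refine ⟨B, h, mainAssumption_crossProduct_of_surjective (T.withTensor B) h
    -- The kernel is spanned by the same net with `c 1` and `c 2` exchanged. As `b` is unimodular,
    -- `coordBivector b i` becomes `b i`, and the cross tensor is again a sparse net.
    (sparseNet (coordBivector b) ![c 0, c 2, c 1, c 3]) (fun i => ?_) fun x => ?_⟩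
  · rw [mem_crossKernel_iff]
    intro u
    have h1 : contractionWV.flip (sparseNet (coordBivector b) ![c 0, c 2, c 1, c 3] i) ∘ₗ
        (T.withTensor B).slice = 0 := a.ext fun j => by
      rw [LinearMap.comp_apply, LinearMap.flip_apply]
      refine (congrArg (fun t => contractionWV t _) (hB j)).trans ?_
      fin_cases i <;> fin_cases j <;>
        simp [sparseNet, contractionWV_tmul, interiorProduct_coordBivector]
    exact LinearMap.congr_fun h1 u
  · obtain ⟨e, he⟩ := exists_contractionWV_sparseNet b
      (fun l => Dual.eval ℂ T.V ((![c 0, c 2, c 1, c 3] : Fin 4 → T.V) l))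
      ![c.dualBasis 0, c.dualBasis 2, c.dualBasis 1, c.dualBasis 3]
      (fun l m => by fin_cases l <;> fin_cases m <;> simp) x
    refine ⟨e, funext fun i => Eq.trans ?_ (he i)⟩
    refine congrArg (fun t => contractionWV t e) ?_
    change TensorProduct.map LinearMap.id (evalEquiv ℂ T.V).toLinearMap (TensorProduct.map
      (wedgeTwoDualToSelf T.oW) LinearMap.id _) = _
    fin_cases i <;> simp [sparseNet, wedgeTwoDualToSelf_coordBivector hb]

end OrientedTensor

theorem mainTheorem5 (T : OrientedTensor.{u}) :
    (∀ h : T.MainAssumption,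
      finrank ℂ T.crossKernel = 3 ∧
      Function.Injective T.crossInclusion ∧
      (∃! o : ⋀[ℂ]^3 T.crossKernel ≃ₗ[ℂ] ℂ, T.IsInducedOrientation o) ∧
      T.IsInducedOrientation (T.crossProduct h).oU) ∧
    (∀ (h : T.MainAssumption) (h' : (T.crossProduct h).MainAssumption),
      ((T.crossProduct h).crossProduct h').MainAssumption ∧
      (∃! φ : T.U ≃ₗ[ℂ] ((T.crossProduct h).crossProduct h').U,
        T.CarriesTensor ((T.crossProduct h).crossProduct h') φ
          (LinearEquiv.refl ℂ T.W) (evalEquiv ℂ T.V)) ∧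
      ((T.crossProduct h).crossProduct h').oW = T.oW ∧
      (∀ ξ : ⋀[ℂ]^4 (Dual ℂ (Dual ℂ (Dual ℂ T.V))),
        ((T.crossProduct h).crossProduct h').oV ξ =
          T.oV (exteriorPower.map 4 (evalEquiv ℂ T.V).toLinearMap.dualMap ξ))) ∧
    IsZariskiOpen {B | (T.withTensor B).MainAssumption} ∧
    IsZariskiOpen {B | ∃ h : (T.withTensor B).MainAssumption,
      ((T.withTensor B).crossProduct h).MainAssumption} ∧
    {B | ∃ h : (T.withTensor B).MainAssumption,
      ((T.withTensor B).crossProduct h).MainAssumption}.Nonempty := by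
  refine ⟨fun h => ⟨h.finrank_crossKernel, T.crossInclusion_injective,
    ⟨(T.crossProduct h).oU, T.isInducedOrientation_crossProduct h, fun o ho =>
      ho.unique T h (T.isInducedOrientation_crossProduct h)⟩,
    T.isInducedOrientation_crossProduct h⟩, fun h h' => ⟨T.mainAssumption_doubleCross h h',
      ⟨T.doubleCrossEquiv h h', (T.carriesTensor_doubleCross_iff h h' _).2 rfl,
        fun φ hφ => (T.carriesTensor_doubleCross_iff h h' φ).1 hφ⟩, rfl,
      T.dualOrientation_dualOrientation h h'⟩,
    T.isZariskiOpen_mainAssumption, T.isZariskiOpen_mainAssumption_crossProduct,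
    T.nonempty_mainAssumption_crossProduct⟩
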